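/- Conventions. Let $X$ be a finite $T_0$-space. For $x\in X$ let $U_x$ be the intersection of all open sets containing $x$, and order $X$ by $x\le y$ if and only if $x\in U_y$. Let $\mathcal K(X)$ be the finite simplicial complex with vertex set $X$ whose simplices are the non-empty chains of $X$. A continuous map $f:X\to Y$ of finite $T_0$-spaces induces the simplicial map $\mathcal K(f):\mathcal K(X)\to\mathcal K(Y)$ that equals $f$ on vertices. The map $f$ is *distinguished* if $f^{-1}(U_y)$ is contractible for every $y\in Y$. A point $x\in X$ is a *weak point* if $U_x\smallsetminus\{x\}$ or $\overline{\{x\}}\smallsetminus\{x\}$ is contractible. Removing a weak point is an *elementary collapse* of finite spaces. A space $Z$ *collapses* to a subspace $A$, or $A$ *expands* to $Z$, if $A$ is obtained from $Z$ by finitely many (possibly zero) elementary collapses. The *non-Hausdorff mapping cylinder* $B(f)$ is the finite $T_0$-space with underlying set $X\sqcup Y$ whose order restricts to the given orders on $X$ and on $Y$, with $x\le y$ if and only if $f(x)\le y$, and never $y\le x$, for $x\in X$, $y\in Y$. Its open sets are the down-sets. For finite simplicial complexes, $K$ collapses to a subcomplex $L$ by an *elementary collapse* if there are a (non-empty) simplex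 $S$ of $K$ and a vertex $a$ of $K$ not in $S$ with $K=L\cup aS$ and $L\cap aS=a\dot S$, where $\dot S$ is the boundary of $S$. An *expansion* is the realization $|L|\to|K|$ of an isomorphism of $L$ onto a subcomplex of $K$ to which $K$ collapses by finitely many (possibly zero) elementary collapses. A homotopy equivalence $|K|\to|L|$ is a *simple homotopy equivalence* if it is homotopic to the composite of a finite sequence of maps $|K|\to|K_1|\to\cdots\to|K_n|\to|L|$ ($K_i$ finite simplicial complexes), each of them an expansion or a homotopy inverse of one. **Theorem.** Let $f:X\to Y$ be a distinguished map between finite $T_0$-spaces. Then $|\mathcal K(f)|:|\mathcal K(X)|\to|\mathcal K(Y)|$ is a simple homotopy equivalence. Moreover, under the canonical inclusions $X\hookrightarrow B(f)$ and $Y\hookrightarrow B(f)$, both $X$ and $Y$ expand to $B(f)$. -/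

import Mathlib

open Topology

universe u

noncomputable section

namespace FiniteSpaces

/-! ### Finite spaces -/

section Spaces

variable {X Y : Type u} [TopologicalSpace X] [TopologicalSpace Y]

/-- The minimal open set `U_x`: the intersection of all open sets containing `x`. -/
def minOpen (x : X) : Set X := nhdsKer {x}

theorem mem_minOpen_iff {a b : X} : a ∈ minOpen b ↔ a ⤳ b := by
  simp only [minOpen, mem_nhdsKer, Set.singleton_subset_iff, specializes_iff_forall_open]

theorem map_mem_minOpen (f : C(X, Y)) {a b : X} (h : a ∈ minOpen b) : f a ∈ minOpen (f b) :=
  mem_minOpen_iff.2 ((mem_minOpen_iff.1 h).map f.continuous)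

/-- The map `f` is distinguished if the preimage of every minimal open set, with the subspace
topology, is contractible. -/
def IsDistinguished (f : C(X, Y)) : Prop :=
  ∀ y : Y, ContractibleSpace (f ⁻¹' minOpen y)

/-- A weak (beat) point: `U_x \ {x}` is contractible or `closure {x} \ {x}` is contractible. -/
def IsWeakPoint (x : X) : Prop :=
  ContractibleSpace ↥(minOpen x \ {x}) ∨ ContractibleSpace ↥(closure {x} \ {x})

/-- Elementary collapse between two subspaces `A`, `A'` of a space: `A'` is obtained from `A` by
removing a weak point of the space `A` (with the subspace topology). -/
def ElementaryCollapse (A A' : Set X) : Prop :=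
  ∃ x : A, IsWeakPoint x ∧ A' = A \ {(x : X)}

/-- The map `i : X → Y` exhibits `Y` as an expansion of `X`: it is a homeomorphism onto a
subspace `i(X)` of `Y`, and `Y` collapses to `i(X)` by a finite sequence of elementary
collapses. -/
def IsSpaceExpansion (i : X → Y) : Prop :=
  IsEmbedding i ∧ Relation.ReflTransGen ElementaryCollapse Set.univ (Set.range i)

end Spaces

/-! ### The non-Hausdorff mapping cylinder -/

section Cylinder

variable {X Y : Type u} [TopologicalSpace X] [TopologicalSpace Y]

/-- The underlying set `X ⊔ Y` of the non-Hausdorff mapping cylinder of `f`. -/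
def Cylinder (_f : C(X, Y)) : Type u := X ⊕ Y

namespace Cylinder

/-- The order of the cylinder. In a finite space `a ≤ b` means `a ∈ U_b`. -/
def le (f : C(X, Y)) : X ⊕ Y → X ⊕ Y → Prop
  | .inl a, .inl b => a ∈ minOpen b
  | .inr a, .inr b => a ∈ minOpen b
  | .inl a, .inr b => f a ∈ minOpen b
  | .inr _, .inl _ => False

/-- The topology associated to the order: the open sets are the down-sets. -/
instance (f : C(X, Y)) : TopologicalSpace (Cylinder f) where
  IsOpen s := ∀ a b : X ⊕ Y, le f a b → b ∈ s → a ∈ s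
  isOpen_univ _ _ _ _ := trivial
  isOpen_inter _ _ hs ht a b hab hb := ⟨hs a b hab hb.1, ht a b hab hb.2⟩
  isOpen_sUnion _ h a b hab := fun ⟨t, ht, hb⟩ => ⟨t, ht, h t ht a b hab hb⟩

/-- The inclusion of `X`. -/
def inl (f : C(X, Y)) (x : X) : Cylinder f := Sum.inl x

/-- The inclusion of `Y`. -/
def inr (f : C(X, Y)) (y : Y) : Cylinder f := Sum.inr y

theorem le_refl (f : C(X, Y)) (a : X ⊕ Y) : le f a a := by
  cases a <;> exact mem_minOpen_iff.2 specializes_rfl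

theorem le_trans (f : C(X, Y)) {a b c : X ⊕ Y} (hab : le f a b) (hbc : le f b c) :
    le f a c := by
  rcases a with a | a <;> rcases b with b | b <;> rcases c with c | c <;>
    simp only [le, mem_minOpen_iff] at hab hbc ⊢
  · exact hab.trans hbc
  · exact (hab.map f.continuous).trans hbc
  · exact hab.trans hbc
  · exact hab.trans hbc

/-- The preorder associated to the topology of the cylinder is the order that defines it. -/
theorem mem_minOpen_iff_le (f : C(X, Y)) (a b : Cylinder f) : a ∈ minOpen b ↔ le f a b := by
  rw [mem_minOpen_iff, specializes_iff_forall_open]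
  refine ⟨fun h => h {c | le f c b} (fun _ _ hcd hd => le_trans f hcd hd) (le_refl f b),
    fun h s hs hb => hs a b h hb⟩

/-- The cylinder of a map between T₀-spaces is a T₀-space. -/
instance (f : C(X, Y)) [T0Space X] [T0Space Y] : T0Space (Cylinder f) where
  t0 a b h := by
    have h1 := (mem_minOpen_iff_le f a b).1 (mem_minOpen_iff.2 h.specializes)
    have h2 := (mem_minOpen_iff_le f b a).1 (mem_minOpen_iff.2 h.specializes')
    rcases a with a | a <;> rcases b with b | b <;>
      simp only [le, mem_minOpen_iff] at h1 h2
    · exact congrArg Sum.inl (h1.antisymm h2).eq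
    · exact congrArg Sum.inr (h1.antisymm h2).eq

/-- The cylinder of a map between finite spaces is finite. -/
instance (f : C(X, Y)) [Finite X] [Finite Y] : Finite (Cylinder f) :=
  inferInstanceAs (Finite (X ⊕ Y))

end Cylinder

end Cylinder

/-! ### Finite simplicial complexes, their realizations and simplicial maps -/

/-- A finite simplicial complex: an abstract simplicial complex on a finite set of vertices. -/
structure FinComplex : Type (u + 1) where
  /-- the vertices -/
  Vertex : Type u
  [fintype : Fintype Vertex]
  /-- the simplices -/
  cplx : AbstractSimplicialComplex Vertex

attribute [instance] FinComplex.fintype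

/-- The geometric realization `|K|`: the points of the standard simplex on the vertices of `K`
(with the Euclidean topology) whose support spans a simplex of `K`. -/
def FinComplex.Realization (K : FinComplex.{u}) : Type u :=
  {p : stdSimplex ℝ K.Vertex // ∃ s ∈ K.cplx, ∀ v, p v ≠ 0 → v ∈ s}

instance (K : FinComplex.{u}) : TopologicalSpace K.Realization :=
  inferInstanceAs (TopologicalSpace {_p : stdSimplex ℝ K.Vertex // _})

open Classical in
/-- Simplicial maps: maps of vertices which send simplices to simplices. -/
structure SimplicialMap (K L : FinComplex.{u}) where
  /-- the map on vertices -/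
  toFun : K.Vertex → L.Vertex
  image_mem : ∀ s ∈ K.cplx, s.image toFun ∈ L.cplx

/-- The realization `|φ| : |K| → |L|`, the affine extension of the map on vertices. -/
def SimplicialMap.realize {K L : FinComplex.{u}} (φ : SimplicialMap K L) :
    C(K.Realization, L.Realization) where
  toFun p := ⟨stdSimplex.map φ.toFun p.1, by
    classical
    obtain ⟨s, hs, hp⟩ := p.2
    refine ⟨s.image φ.toFun, by convert φ.image_mem s hs, fun w hw => ?_⟩
    rw [stdSimplex.map_coe, FunOnFinite.linearMap_apply_apply] at hw
    obtain ⟨v, hv, hv0⟩ := Finset.exists_ne_zero_of_sum_ne_zero hw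
    exact Finset.mem_image.2 ⟨v, hp v hv0, by simpa using hv⟩⟩
  continuous_toFun :=
    ((stdSimplex.continuous_map φ.toFun).comp continuous_subtype_val).subtype_mk _

/-! ### Simplicial collapses -/

section Collapse

variable {V : Type u}

/-- The complex of all faces of the simplex with vertex set `S`. -/
def fullSimplex (S : Finset V) : PreAbstractSimplicialComplex V where
  faces := {t | t.Nonempty ∧ t ⊆ S}
  isRelLowerSet_faces _ ht := ⟨ht.1, fun _ hu hn => ⟨hn, hu.trans ht.2⟩⟩

open Classical in
/-- The cone with apex `a` over the boundary of the simplex `S`: its simplices are the faces of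
`aS` which do not contain `S`. -/
def coneBoundary (a : V) (S : Finset V) : PreAbstractSimplicialComplex V where
  faces := {t | t.Nonempty ∧ t ⊆ insert a S ∧ ¬ S ⊆ t}
  isRelLowerSet_faces _ ht :=
    ⟨ht.1, fun _ hu hn => ⟨hn, hu.trans ht.2.1, fun h => ht.2.2 (h.trans hu)⟩⟩

open Classical in
/-- Elementary simplicial collapse from `K` to its subcomplex `L`: for some simplex `S` and
vertex `a ∉ S` one has `K = L ∪ aS` and `L ∩ aS = a ∂S`. -/
def ElementarySimplicialCollapse (K L : PreAbstractSimplicialComplex V) : Prop :=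
  ∃ (S : Finset V) (a : V), S.Nonempty ∧ a ∉ S ∧
    K = L ⊔ fullSimplex (insert a S) ∧ L ⊓ fullSimplex (insert a S) = coneBoundary a S

end Collapse

open Classical in
/-- The simplicial map `φ : L → K` is an expansion: it is an isomorphism onto a subcomplex `φ(L)`
of `K`, and `K` collapses to `φ(L)` by a finite sequence of elementary simplicial collapses. -/
def SimplicialMap.IsExpansion {L K : FinComplex.{u}} (φ : SimplicialMap L K) : Prop :=
  Function.Injective φ.toFun ∧
    Relation.ReflTransGen ElementarySimplicialCollapse K.cplx.toPreAbstractSimplicialComplex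
      (L.cplx.toPreAbstractSimplicialComplex.map φ.toFun)

/-! ### Simple homotopy equivalences -/

/-- The maps `g` and `f` are homotopy inverse to each other. -/
def IsHomotopyInverse {A B : Type u} [TopologicalSpace A] [TopologicalSpace B]
    (g : C(B, A)) (f : C(A, B)) : Prop :=
  (g.comp f).Homotopic (ContinuousMap.id A) ∧ (f.comp g).Homotopic (ContinuousMap.id B)

/-- The composites of finite sequences of maps `|K| → |K₁| → ⋯ → |Kₙ| → |L|`, each of them an
expansion or a homotopy inverse of one. -/
inductive IsExpansionComposite :
    {K L : FinComplex.{u}} → C(K.Realization, L.Realization) → Prop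
  | refl (K : FinComplex.{u}) : IsExpansionComposite (ContinuousMap.id K.Realization)
  | expand {K L M : FinComplex.{u}} {g : C(K.Realization, L.Realization)}
      (hg : IsExpansionComposite g) (φ : SimplicialMap L M) (hφ : φ.IsExpansion) :
      IsExpansionComposite (φ.realize.comp g)
  | contract {K L M : FinComplex.{u}} {g : C(K.Realization, L.Realization)}
      (hg : IsExpansionComposite g) (φ : SimplicialMap M L) (hφ : φ.IsExpansion)
      (r : C(L.Realization, M.Realization)) (hr : IsHomotopyInverse r φ.realize) :
      IsExpansionComposite (r.comp g)

/-- A map `|K| → |L|` is a simple homotopy equivalence if it is a homotopy equivalence and is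
homotopic to a composite of expansions and homotopy inverses of expansions. -/
def IsSimpleHomotopyEquiv {K L : FinComplex.{u}} (F : C(K.Realization, L.Realization)) : Prop :=
  (∃ G : C(L.Realization, K.Realization), IsHomotopyInverse G F) ∧
    ∃ g : C(K.Realization, L.Realization), IsExpansionComposite g ∧ F.Homotopic g

/-! ### The simplicial complex of a finite space -/

/-- The complex `𝒦(X)` of a finite T₀-space: its simplices are the nonempty chains of `X`, where
`a ≤ b` means `a ∈ U_b`. -/
def orderComplex (X : Type u) [TopologicalSpace X] [Fintype X] : FinComplex.{u} where
  Vertex := X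
  cplx :=
    { faces := {s | s.Nonempty ∧ IsChain (fun a b => a ∈ minOpen b) (s : Set X)}
      isRelLowerSet_faces := fun _ hs =>
        ⟨hs.1, fun _ ht hn => ⟨hn, hs.2.mono (Finset.coe_subset.2 ht)⟩⟩
      singleton_mem := fun v => by simp [Set.mem_ofPred_eq] }

/-- The simplicial map `𝒦(f) : 𝒦(X) → 𝒦(Y)`, equal to `f` on vertices. -/
def orderComplexMap {X Y : Type u} [TopologicalSpace X] [TopologicalSpace Y] [Fintype X]
    [Fintype Y] (f : C(X, Y)) : SimplicialMap (orderComplex X) (orderComplex Y) where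
  toFun := f
  image_mem := by
    classical
    rintro s ⟨hs, hc⟩
    refine ⟨hs.image _, ?_⟩
    intro a ha b hb hab
    obtain ⟨a', ha', rfl⟩ := Finset.mem_image.1 (Finset.mem_coe.1 ha)
    obtain ⟨b', hb', rfl⟩ := Finset.mem_image.1 (Finset.mem_coe.1 hb)
    exact (hc ha' hb' fun h => hab (h ▸ rfl)).imp (map_mem_minOpen f) (map_mem_minOpen f)

end FiniteSpaces

end

/-!
Order the points of a finite `T₀`-space by specialization. If `x` is a weak point, the points
strictly below it, or those strictly above it, form a contractible space, which by Stong's theorem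
is dismantlable: without beat points a homotopy starting at the identity is constant, because a
self-map comparable to the identity is the identity. A beat point `b` with witness `c` makes `c`
the apex of a cone which is the link of the edge `{x, b}` in the order complex, so this edge can be
removed by simplicial collapses; going through the dismantling, the link of `x` shrinks to a cone,
after which `x` itself can be removed. Hence collapses of finite spaces induce collapses of order
complexes. An elementary simplicial collapse is a deformation retraction, so expansions of
complexes are homotopy equivalences.

Removing the points of `Y` from the cylinder, minimal points first, the space below `y` at each
stage is `f ⁻¹(U_y)`, which is contractible as `f` is distinguished; removing the points of `X`,
maximal points first, the space above `x` has the least point `f x`. So the cylinder collapses to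
both `X` and `Y`, and `f` is the inclusion of `X` followed by the retraction onto `Y`, which is a
homotopy inverse of the inclusion of `Y`.
-/

noncomputable section

namespace FiniteSpaces

section BeatPoints

open Relation Function

variable {α β : Type*} {r : α → α → Prop} {B : Set α} {b c d : α}

/-- For a partial order `r` this says that `b` is a beat point of `B` with witness `c`: either `c`
is the greatest element of `B` strictly below `b`, or it is the least one strictly above `b`.
Stating both halves for the comparable pair `b`, `c` makes the notion invariant under passing to
the opposite relation. -/
structure IsBeatPoint (r : α → α → Prop) (B : Set α) (b c : α) : Prop where
  mem : b ∈ B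
  witness_mem : c ∈ B
  witness_ne : c ≠ b
  comparable : SymmGen r c b
  below : ∀ d ∈ B, d ≠ b → r d b → r d c
  above : ∀ d ∈ B, d ≠ b → r b d → r c d

theorem IsBeatPoint.swap (h : IsBeatPoint r B b c) : IsBeatPoint (swap r) B b c where
  mem := h.mem
  witness_mem := h.witness_mem
  witness_ne := h.witness_ne
  comparable := h.comparable.symm
  below := h.above
  above := h.below

theorem IsBeatPoint.map {s : β → β → Prop} {b c : β} (h : IsBeatPoint s Set.univ b c)
    (g : s ↪r r) : IsBeatPoint r (Set.range g) (g b) (g c) where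
  mem := Set.mem_range_self b
  witness_mem := Set.mem_range_self c
  witness_ne := g.injective.ne h.witness_ne
  comparable := h.comparable.imp g.map_rel_iff.2 g.map_rel_iff.2
  below := by
    rintro _ ⟨d, rfl⟩ hd hdb
    exact g.map_rel_iff.2 (h.below d trivial (ne_of_apply_ne g hd) (g.map_rel_iff.1 hdb))
  above := by
    rintro _ ⟨d, rfl⟩ hd hbd
    exact g.map_rel_iff.2 (h.above d trivial (ne_of_apply_ne g hd) (g.map_rel_iff.1 hbd))

theorem IsBeatPoint.symmGen_witness (h : IsBeatPoint r B b c) (hd : d ∈ B)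
    (hdb : d ≠ b → SymmGen r d b) : SymmGen r d c := by
  by_cases hne : d = b
  · exact hne ▸ h.comparable.symm
  · exact (hdb hne).imp (h.below d hd hne) (h.above d hd hne)

/-- A set is dismantlable if it can be reduced to a single point by successively removing beat
points. -/
inductive Dismantlable (r : α → α → Prop) : Set α → Prop
  | point (m : α) : Dismantlable r {m}
  | step {B : Set α} {b c : α} (hb : IsBeatPoint r B b c) (h : Dismantlable r (B \ {b})) :
      Dismantlable r B

theorem Dismantlable.swap (h : Dismantlable r B) : Dismantlable (swap r) B := by
  induction h with
  | point m => exact .point m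
  | step hb _ ih => exact .step hb.swap ih

theorem wellFounded_rel_and_ne [Finite α] (r : α → α → Prop) [IsPartialOrder α r] :
    WellFounded fun a b => r a b ∧ a ≠ b := by
  have : IsTrans α fun a b => r a b ∧ a ≠ b :=
    ⟨fun a b c hab hbc => ⟨_root_.trans hab.1 hbc.1, fun hac =>
      hab.2 (antisymm hab.1 (hac ▸ hbc.1))⟩⟩
  have : Std.Irrefl fun a b => r a b ∧ a ≠ b := ⟨fun _ h => h.2 rfl⟩
  exact Finite.wellFounded_of_trans_of_irrefl _

theorem eq_self_of_forall_not_isBeatPoint [Finite α] [IsPartialOrder α r]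
    (hr : ∀ b c, ¬ IsBeatPoint r Set.univ b c) {g : α → α} (hg : ∀ a b, r a b → r (g a) (g b))
    (hle : ∀ a, r (g a) a) (a : α) : g a = a := by
  induction a using (wellFounded_rel_and_ne r).induction with
  | _ a ih =>
    by_contra hne
    exact hr a (g a)
      { mem := trivial
        witness_mem := trivial
        witness_ne := hne
        comparable := .inl (hle a)
        below := fun d _ hda h => ih d ⟨h, hda⟩ ▸ hg d a h
        above := fun d _ _ h => _root_.trans (hle a) h }

end BeatPoints

section FiniteSpace

variable {X : Type*} [TopologicalSpace X] {A B : Type*} [TopologicalSpace A] [TopologicalSpace B]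

instance [T0Space X] : IsPartialOrder X (· ⤳ ·) where
  refl := specializes_refl
  trans _ _ _ := Specializes.trans
  antisymm _ _ hab hba := (hab.antisymm hba).eq

theorem continuous_of_specializes [AlexandrovDiscrete A] {g : A → B}
    (h : ∀ a b : A, a ⤳ b → g a ⤳ g b) : Continuous g where
  isOpen_preimage s hs := by
    rw [isOpen_iff_forall_specializes]
    exact fun a b hab hb => (h a b hab).mem_open hs hb

theorem isEmbedding_of_specializes_iff [AlexandrovDiscrete A] [T0Space A] [AlexandrovDiscrete B]
    {g : A → B} (h : ∀ a b : A, g a ⤳ g b ↔ a ⤳ b) : IsEmbedding g := by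
  have hg : Continuous g := continuous_of_specializes fun a b => (h a b).2
  refine ⟨⟨le_antisymm hg.le_induced fun s hs => ?_⟩, fun a b hab => ?_⟩
  · refine isOpen_induced_iff.2 ⟨nhdsKer (g '' s), isOpen_nhdsKer, ?_⟩
    ext a
    rw [Set.mem_preimage, mem_nhdsKer_iff_specializes]
    refine ⟨?_, fun ha => ⟨g a, Set.mem_image_of_mem g ha, specializes_rfl⟩⟩
    rintro ⟨_, ⟨b, hb, rfl⟩, hab⟩
    exact ((h a b).1 hab).mem_open hs hb
  · exact (((h a b).1 (hab ▸ specializes_rfl)).antisymm ((h b a).1 (hab ▸ specializes_rfl))).eq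

theorem eventually_forall_specializes {T : Type*} [TopologicalSpace T] [Finite A]
    [AlexandrovDiscrete B] (F : C(T × A, B)) (t₀ : T) :
    ∀ᶠ t in 𝓝 t₀, ∀ a, F (t, a) ⤳ F (t₀, a) := by
  refine Filter.eventually_all.2 fun a => ?_
  have hF : ContinuousAt (fun t => F (t, a)) t₀ := by fun_prop
  filter_upwards [hF (isOpen_nhdsKer.mem_nhds (subset_nhdsKer (Set.mem_singleton _)))] with t ht
  exact mem_minOpen_iff.1 ht

theorem eq_self_of_preconnected_of_forall_not_isBeatPoint {T : Type*} [TopologicalSpace T]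
    [PreconnectedSpace T] [Finite X] [T0Space X]
    (hX : ∀ b c : X, ¬ IsBeatPoint (· ⤳ ·) Set.univ b c) (F : C(T × X, X)) {t₀ : T}
    (h₀ : ∀ x, F (t₀, x) = x) (t : T) (x : X) : F (t, x) = x := by
  have hF (t : T) (a b : X) (hab : a ⤳ b) : F (t, a) ⤳ F (t, b) :=
    (specializes_rfl.prod hab).map F.continuous
  have hclopen : IsClopen {t | ∀ x, F (t, x) = x} := by
    constructor
    · rw [← isOpen_compl_iff, isOpen_iff_mem_nhds]
      intro s hs
      filter_upwards [eventually_forall_specializes F s] with t ht h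
      exact hs (eq_self_of_forall_not_isBeatPoint (fun b c hb => hX b c hb.swap)
        (fun a b => hF s b a) fun x => by simpa only [h x] using ht x)
    · rw [isOpen_iff_mem_nhds]
      intro s hs
      filter_upwards [eventually_forall_specializes F s] with t ht
      exact eq_self_of_forall_not_isBeatPoint hX (hF t) fun x => by simpa only [hs x] using ht x
  have ht : t ∈ {t | ∀ x, F (t, x) = x} := hclopen.eq_univ ⟨t₀, h₀⟩ ▸ Set.mem_univ t
  exact ht x

theorem exists_isBeatPoint [Finite X] [T0Space X] [ContractibleSpace X] [Nontrivial X] :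
    ∃ b c : X, IsBeatPoint (· ⤳ ·) Set.univ b c := by
  by_contra! hX
  obtain ⟨y, ⟨H⟩⟩ := id_nullhomotopic X
  obtain ⟨x, hx⟩ := exists_ne y
  refine hx ?_
  rw [← eq_self_of_preconnected_of_forall_not_isBeatPoint hX H.toContinuousMap H.apply_zero 1 x]
  exact H.apply_one x

theorem exists_isBeatPoint_of_nontrivial [Finite X] [T0Space X] {B : Set X} [ContractibleSpace B]
    (hB : B.Nontrivial) : ∃ b c : X, IsBeatPoint (· ⤳ ·) B b c := by
  have := hB.coe_sort
  obtain ⟨b, c, hbc⟩ := exists_isBeatPoint (X := B)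
  refine ⟨b, c, ?_⟩
  convert! hbc.map ⟨.subtype (· ∈ B), (subtype_specializes_iff _ _).symm⟩
  exact Subtype.range_coe.symm

theorem contractibleSpace_of_retract [ContractibleSpace B] (i : C(A, B)) (r : C(B, A))
    (h : r.comp i = .id A) : ContractibleSpace A := by
  rw [contractible_iff_id_nullhomotopic, ← h]
  exact ((id_nullhomotopic B).comp_right r).comp_left i

theorem IsBeatPoint.contractibleSpace_sdiff_singleton [AlexandrovDiscrete X] {B : Set X} {b c : X}
    [ContractibleSpace B] (h : IsBeatPoint (· ⤳ ·) B b c) :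
    ContractibleSpace ↥(B \ {b}) := by
  classical
  let r (d : B) : ↥(B \ {b}) :=
    if hd : (d : X) = b then ⟨c, h.witness_mem, h.witness_ne⟩ else ⟨d, d.2, hd⟩
  have hr : Continuous r := continuous_of_specializes fun d e hde => by
    rw [subtype_specializes_iff] at hde ⊢
    by_cases hd : (d : X) = b <;> by_cases he : (e : X) = b <;>
      simp only [r, hd, he, dite_true, dite_false]
    · exact specializes_rfl
    · exact h.above e e.2 he (hd ▸ hde)
    · exact h.below d d.2 hd (he ▸ hde)
    · exact hde
  refine contractibleSpace_of_retract
    ⟨Set.inclusion Set.sdiff_subset, continuous_inclusion Set.sdiff_subset⟩ ⟨r, hr⟩ ?_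
  ext d
  exact congrArg Subtype.val (dif_neg d.2.2)

theorem dismantlable_of_contractibleSpace [Finite X] [T0Space X] (B : Set X)
    [hB : ContractibleSpace B] : Dismantlable (· ⤳ ·) B := by
  induction B using (wellFounded_lt (α := Set X)).induction generalizing hB with
  | _ B ih =>
    obtain hsub | hnontriv := B.subsingleton_or_nontrivial
    · obtain ⟨m, hm⟩ : B.Nonempty := Set.nonempty_coe_sort.1 inferInstance
      exact hsub.eq_singleton_of_mem hm ▸ .point m
    · obtain ⟨b, c, hbc⟩ := exists_isBeatPoint_of_nontrivial hnontriv
      exact .step hbc (ih _ (Set.sdiff_singleton_ssubset.2 hbc.mem)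
        (hB := hbc.contractibleSpace_sdiff_singleton))

theorem homotopic_of_specializes {f g : C(A, B)} (h : ∀ a, f a ⤳ g a) : f.Homotopic g := by
  classical
  let H (p : unitInterval × A) : B := if p.1 = 1 then g p.2 else f p.2
  have hH : Continuous H := by
    refine continuous_def.2 fun U hU => ?_
    have hpre : H ⁻¹' U = {p | p.1 ≠ 1} ∩ (f ∘ Prod.snd) ⁻¹' U ∪ (g ∘ Prod.snd) ⁻¹' U := by
      ext ⟨t, a⟩
      by_cases ht : t = 1
      · simp [H, ht]
      · simpa [H, ht] using fun ha => (h a).mem_open hU ha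
    rw [hpre]
    exact ((isOpen_ne.preimage continuous_fst).inter (hU.preimage (by fun_prop))).union
      (hU.preimage (by fun_prop))
  exact ⟨⟨⟨H, hH⟩, fun a => by simp [H], fun a => by simp [H]⟩⟩

theorem contractibleSpace_of_forall_specializes {c : A} (h : ∀ a, c ⤳ a) :
    ContractibleSpace A := by
  rw [contractible_iff_id_nullhomotopic]
  exact ⟨c, (homotopic_of_specializes (f := .const A c) (g := .id A) h).symm⟩

end FiniteSpace

section WeakPoints

open Function

/-- The elements of `A` strictly below `x`; taken for the opposite relation, the elements of `A`
strictly above `x`. -/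
def strictlyBelow {α : Type*} (r : α → α → Prop) (A : Set α) (x : α) : Set α :=
  {a ∈ A | r a x ∧ a ≠ x}

variable {X : Type*} [TopologicalSpace X] {A : Set X}

theorem contractibleSpace_image_subtypeVal_iff {s : Set A} :
    ContractibleSpace ↥((↑) '' s : Set X) ↔ ContractibleSpace s :=
  (IsEmbedding.subtypeVal.homeomorphImage s).contractibleSpace_iff.symm

theorem image_minOpen_sdiff_singleton (x : A) :
    (↑) '' (minOpen x \ {x}) = strictlyBelow (· ⤳ ·) A (x : X) := by
  ext a
  constructor
  · rintro ⟨a, ⟨hax, hne⟩, rfl⟩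
    exact ⟨a.2, (mem_minOpen_iff.1 hax).map continuous_subtype_val,
      Subtype.coe_injective.ne hne⟩
  · rintro ⟨ha, hax, hne⟩
    exact ⟨⟨a, ha⟩, ⟨mem_minOpen_iff.2 ((subtype_specializes_iff _ _).2 hax),
      ne_of_apply_ne Subtype.val hne⟩, rfl⟩

theorem image_closure_sdiff_singleton (x : A) :
    (↑) '' (closure {x} \ {x}) = strictlyBelow (swap (· ⤳ ·)) A (x : X) := by
  ext a
  constructor
  · rintro ⟨a, ⟨hxa, hne⟩, rfl⟩
    exact ⟨a.2, (specializes_iff_mem_closure.2 hxa).map continuous_subtype_val,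
      Subtype.coe_injective.ne hne⟩
  · rintro ⟨ha, hxa, hne⟩
    exact ⟨⟨a, ha⟩, ⟨specializes_iff_mem_closure.1 ((subtype_specializes_iff _ _).2 hxa),
      ne_of_apply_ne Subtype.val hne⟩, rfl⟩

theorem isWeakPoint_iff_contractibleSpace_strictlyBelow (x : A) :
    IsWeakPoint x ↔ ContractibleSpace (strictlyBelow (· ⤳ ·) A (x : X)) ∨
      ContractibleSpace (strictlyBelow (swap (· ⤳ ·)) A (x : X)) := by
  rw [← image_minOpen_sdiff_singleton, ← image_closure_sdiff_singleton,
    contractibleSpace_image_subtypeVal_iff, contractibleSpace_image_subtypeVal_iff, IsWeakPoint]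

end WeakPoints

section Collapses

open Relation

variable {V : Type*} {K L : PreAbstractSimplicialComplex V} {S σ s t : Finset V} {a c : V}

theorem nonempty_of_mem (hs : s ∈ K) : s.Nonempty :=
  K.isRelLowerSet_faces.prop_of_mem hs

theorem mem_of_subset (hs : s ∈ K) (hts : t ⊆ s) (ht : t.Nonempty) : t ∈ K :=
  K.isRelLowerSet_faces.mem_of_le hs hts ht

/-- The complex `K` collapses to its subcomplex `L` by finitely many elementary collapses. -/
abbrev CollapsesTo (K L : PreAbstractSimplicialComplex V) : Prop :=
  ReflTransGen ElementarySimplicialCollapse K L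

theorem CollapsesTo.le (h : CollapsesTo K L) : L ≤ K := by
  induction h with
  | refl => exact le_rfl
  | tail _ h ih =>
    obtain ⟨S, a, -, -, rfl, -⟩ := h
    exact le_sup_left.trans ih

/-- The complement of the open star of `σ` in `K`: the simplices which do not have `σ` as a
face. -/
def deleteFace (K : PreAbstractSimplicialComplex V) (σ : Finset V) :
    PreAbstractSimplicialComplex V where
  faces := {s | s ∈ K ∧ ¬ σ ⊆ s}
  isRelLowerSet_faces _ hs :=
    ⟨nonempty_of_mem hs.1, fun _ ht hn => ⟨mem_of_subset hs.1 ht hn, fun h => hs.2 (h.trans ht)⟩⟩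

theorem mem_deleteFace : s ∈ deleteFace K σ ↔ s ∈ K ∧ ¬ σ ⊆ s := Iff.rfl

theorem deleteFace_eq_self (h : ∀ s ∈ K, ¬ σ ⊆ s) : deleteFace K σ = K :=
  le_antisymm (fun _ => And.left) fun s hs => ⟨hs, h s hs⟩

theorem deleteFace_deleteFace (h : σ ⊆ S) : deleteFace (deleteFace K S) σ = deleteFace K σ :=
  le_antisymm (fun _ hs => ⟨hs.1.1, hs.2⟩)
    fun _ hs => ⟨⟨hs.1, fun hS => hs.2 (h.trans hS)⟩, hs.2⟩

theorem deleteFace_lt (hσ : σ ∈ K) : deleteFace K σ < K :=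
  SetLike.lt_iff_le_and_exists.2 ⟨fun _ => And.left, σ, hσ, fun h => h.2 subset_rfl⟩

variable [hV : DecidableEq V]

theorem elementarySimplicialCollapse_iff_exists_free_face :
    ElementarySimplicialCollapse K L ↔ ∃ (S : Finset V) (a : V), S.Nonempty ∧ a ∉ S ∧
      insert a S ∈ K ∧ (∀ t ∈ K, S ⊆ t → t ⊆ insert a S) ∧ L = deleteFace K S := by
  classical
  obtain rfl : hV = fun _ _ => Classical.propDecidable _ := Subsingleton.elim _ _
  constructor
  · rintro ⟨S, a, hS, ha, rfl, hL⟩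
    have hSL (t) (ht : t ∈ L) (hSt : S ⊆ t) : False :=
      have hmem : S ∈ L ⊓ fullSimplex (insert a S) :=
        ⟨mem_of_subset ht hSt hS, hS, Finset.subset_insert a S⟩
      (hL ▸ hmem : S ∈ coneBoundary a S).2.2 subset_rfl
    refine ⟨S, a, hS, ha, .inr ⟨Finset.insert_nonempty a S, subset_rfl⟩, ?_, ?_⟩
    · rintro t (ht | ht) hSt
      · exact (hSL t ht hSt).elim
      · exact ht.2
    · refine le_antisymm (fun t ht => ⟨.inl ht, hSL t ht⟩) fun t => ?_
      rintro ⟨ht | ht, hSt⟩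
      · exact ht
      · exact (hL ▸ ⟨ht.1, ht.2, hSt⟩ : t ∈ L ⊓ fullSimplex (insert a S)).1
  · rintro ⟨S, a, hS, ha, haS, hfree, rfl⟩
    have hfull (t) (ht : t ∈ fullSimplex (insert a S)) : t ∈ K := mem_of_subset haS ht.2 ht.1
    refine ⟨S, a, hS, ha, SetLike.ext fun t => ⟨fun ht => ?_, ?_⟩, SetLike.ext fun t => ?_⟩
    · by_cases hSt : S ⊆ t
      · exact .inr ⟨nonempty_of_mem ht, hfree t ht hSt⟩
      · exact .inl ⟨ht, hSt⟩
    · rintro (ht | ht)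
      · exact ht.1
      · exact hfull t ht
    · exact ⟨fun ht => ⟨ht.2.1, ht.2.2, ht.1.2⟩,
        fun ht => ⟨⟨hfull t ⟨ht.1, ht.2.1⟩, ht.2.2⟩, ht.1, ht.2.1⟩⟩

theorem exists_face_forall_subset_insert [Finite V] (hσ : σ ∈ K) (hc : c ∉ σ) :
    ∃ S ∈ K, σ ⊆ S ∧ c ∉ S ∧ ∀ t ∈ K, S ⊆ t → t ⊆ insert c S := by
  obtain ⟨S, ⟨hSK, hσS, hcS⟩, hmax⟩ :=
    (Set.toFinite {s | s ∈ K ∧ σ ⊆ s ∧ c ∉ s}).exists_maximal ⟨σ, hσ, subset_rfl, hc⟩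
  refine ⟨S, hSK, hσS, hcS, fun t ht hSt => Finset.subset_insert_iff.2 (hmax ?_ ?_)⟩
  · have hσt : σ ⊆ t.erase c := Finset.subset_erase.2 ⟨hσS.trans hSt, hc⟩
    exact ⟨mem_of_subset ht (Finset.erase_subset c t) ((nonempty_of_mem hσ).mono hσt), hσt,
      Finset.notMem_erase c t⟩
  · exact Finset.subset_erase.2 ⟨hSt, hcS⟩

/-- The hypothesis says that the link of `σ` is a cone with apex `c`. -/
theorem collapsesTo_deleteFace_of_forall_insert_mem [Finite V] (hσ : σ.Nonempty) (hc : c ∉ σ)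
    (hlink : ∀ s ∈ K, σ ⊆ s → insert c s ∈ K) : CollapsesTo K (deleteFace K σ) := by
  have : Finite (PreAbstractSimplicialComplex V) :=
    .of_injective _ (SetLike.coe_injective (A := PreAbstractSimplicialComplex V))
  induction K using WellFoundedLT.induction with
  | _ K ih =>
    by_cases hσK : σ ∈ K
    · obtain ⟨S, hSK, hσS, hcS, hfree⟩ := exists_face_forall_subset_insert hσK hc
      have hstep : ElementarySimplicialCollapse K (deleteFace K S) :=
        elementarySimplicialCollapse_iff_exists_free_face.2
          ⟨S, c, hσ.mono hσS, hcS, hlink S hSK hσS, hfree, rfl⟩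
      refine .head hstep (deleteFace_deleteFace hσS ▸ ih _ (deleteFace_lt hSK) fun s hs hσs => ?_)
      exact ⟨hlink s hs.1 hσs, fun hS => hs.2 ((Finset.subset_insert_iff_of_notMem hcS).1 hS)⟩
    · rw [deleteFace_eq_self fun s hs hσs => hσK (mem_of_subset hs hσs hσ)]

end Collapses

section ChainComplex

open Relation Function

variable {α : Type*} {r : α → α → Prop} {A B E : Set α} {x b c : α} {s : Finset α}

/-- The complex of the nonempty finite chains of `r` contained in `A`. -/
def chainComplex (r : α → α → Prop) (A : Set α) : PreAbstractSimplicialComplex α where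
  faces := {s | s.Nonempty ∧ ↑s ⊆ A ∧ IsChain r (s : Set α)}
  isRelLowerSet_faces _ hs := ⟨hs.1, fun _ ht hn =>
    have hts := Finset.coe_subset.2 ht
    ⟨hn, hts.trans hs.2.1, hs.2.2.mono hts⟩⟩

theorem chainComplex_swap : chainComplex (swap r) A = chainComplex r A :=
  SetLike.ext fun _ => and_congr_right fun _ => and_congr_right fun _ =>
    ⟨IsChain.symm, IsChain.symm⟩

theorem deleteFace_chainComplex_singleton :
    deleteFace (chainComplex r A) {x} = chainComplex r (A \ {x}) := by
  refine SetLike.ext fun s => ?_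
  rw [mem_deleteFace, Finset.singleton_subset_iff, ← Finset.mem_coe]
  exact ⟨fun ⟨hs, hx⟩ => ⟨hs.1, Set.subset_sdiff_singleton hs.2.1 hx, hs.2.2⟩,
    fun hs => ⟨⟨hs.1, hs.2.1.trans Set.sdiff_subset, hs.2.2⟩, fun hx => (hs.2.1 hx).2 rfl⟩⟩

/-- The simplices of `K` which do not have any of the edges `{x, e}` with `e ∈ E` as a face.
Removing these edges one by one shrinks the link of `x` and leaves the rest of `K` unchanged. -/
def deleteEdges (K : PreAbstractSimplicialComplex α) (x : α) (E : Set α) :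
    PreAbstractSimplicialComplex α where
  faces := {s | s ∈ K ∧ (x ∈ s → ∀ e ∈ s, e ∉ E)}
  isRelLowerSet_faces _ hs := ⟨nonempty_of_mem hs.1, fun _ ht hn =>
    ⟨mem_of_subset hs.1 ht hn, fun hx e he => hs.2 (ht hx) e (ht he)⟩⟩

variable {K : PreAbstractSimplicialComplex α}

theorem deleteEdges_empty : deleteEdges K x ∅ = K :=
  le_antisymm (fun _ => And.left) fun _ hs => ⟨hs, fun _ _ _ => id⟩

theorem deleteEdges_insert [DecidableEq α] :
    deleteEdges K x (insert b E) = deleteFace (deleteEdges K x E) {x, b} := by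
  refine SetLike.ext fun s => ?_
  rw [mem_deleteFace, Finset.insert_subset_iff, Finset.singleton_subset_iff]
  constructor
  · exact fun hs => ⟨⟨hs.1, fun hx e he hE => hs.2 hx e he (.inr hE)⟩,
      fun h => hs.2 h.1 b h.2 (.inl rfl)⟩
  · rintro ⟨hs, hxb⟩
    refine ⟨hs.1, fun hx e he => ?_⟩
    rintro (rfl | hE)
    · exact hxb ⟨hx, he⟩
    · exact hs.2 hx e he hE

theorem deleteFace_deleteEdges_singleton : deleteFace (deleteEdges K x E) {x} = deleteFace K {x} :=
  le_antisymm (fun _ hs => ⟨hs.1.1, hs.2⟩)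
    fun _ hs => ⟨⟨hs.1, fun hx => (hs.2 (Finset.singleton_subset_iff.2 hx)).elim⟩, hs.2⟩

theorem insert_mem_deleteEdges_chainComplex [DecidableEq α] [IsTrans α r]
    (hs : s ∈ deleteEdges (chainComplex r A) x E) (hx : x ∈ s) (hc : c ∈ strictlyBelow r A x)
    (hcE : c ∉ E) (h : ∀ d ∈ s, d ∈ strictlyBelow r A x → d ≠ c → SymmGen r d c) :
    insert c s ∈ deleteEdges (chainComplex r A) x E := by
  obtain ⟨⟨-, hsA, hchain⟩, hsE⟩ := hs
  refine ⟨⟨Finset.insert_nonempty c s, ?_, ?_⟩, fun _ e he => ?_⟩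
  · rw [Finset.coe_insert]
    exact Set.insert_subset hc.1 hsA
  · rw [Finset.coe_insert]
    refine hchain.insert fun d hd hcd => ?_
    obtain rfl | hdx := eq_or_ne d x
    · exact .inl hc.2.1
    · obtain hdx' | hxd := hchain hd hx hdx
      · exact (h d hd ⟨hsA hd, hdx', hdx⟩ hcd.symm).symm
      · exact .inl (_root_.trans hc.2.1 hxd)
  · obtain rfl | he := Finset.mem_insert.1 he
    · exact hcE
    · exact hsE hx e he

theorem Dismantlable.deleteEdges_chainComplex_collapsesTo [Finite α] [IsTrans α r]
    (hB : Dismantlable r B) (hBx : B ⊆ strictlyBelow r A x) :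
    CollapsesTo (deleteEdges (chainComplex r A) x (strictlyBelow r A x \ B))
      (chainComplex r (A \ {x})) := by
  classical
  induction hB with
  | point m =>
    have hm : m ∈ strictlyBelow r A x := hBx rfl
    rw [← deleteFace_chainComplex_singleton, ← deleteFace_deleteEdges_singleton]
    refine collapsesTo_deleteFace_of_forall_insert_mem (Finset.singleton_nonempty x)
      (Finset.notMem_singleton.2 hm.2.2) fun s hs hxs => ?_
    have hx : x ∈ s := Finset.singleton_subset_iff.1 hxs
    exact insert_mem_deleteEdges_chainComplex hs hx hm (fun h => h.2 rfl)
      fun d hd hdx hdm => (hs.2 hx d hd ⟨hdx, hdm⟩).elim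
  | @step B b c hb _ ih =>
    have hc : c ∈ strictlyBelow r A x := hBx hb.witness_mem
    have hinsert : strictlyBelow r A x \ (B \ {b}) = insert b (strictlyBelow r A x \ B) := by
      rw [Set.sdiff_sdiff_right, Set.inter_eq_right.2 (Set.singleton_subset_iff.2 (hBx hb.mem)),
        Set.union_singleton]
    refine .trans ?_ (ih (Set.sdiff_subset.trans hBx))
    rw [hinsert, deleteEdges_insert]
    refine collapsesTo_deleteFace_of_forall_insert_mem (c := c) (Finset.insert_nonempty x {b}) ?_
      fun s hs hxbs => ?_
    · simp [hc.2.2, hb.witness_ne]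
    rw [Finset.insert_subset_iff, Finset.singleton_subset_iff] at hxbs
    refine insert_mem_deleteEdges_chainComplex hs hxbs.1 hc (fun h => h.2 hb.witness_mem)
      fun d hd hdx _ => ?_
    have hdB : d ∈ B := by_contra fun hdB => hs.2 hxbs.1 d hd ⟨hdx, hdB⟩
    exact hb.symmGen_witness hdB (hs.1.2.2 hd hxbs.2)

theorem Dismantlable.chainComplex_collapsesTo [Finite α] [IsTrans α r]
    (h : Dismantlable r (strictlyBelow r A x)) :
    CollapsesTo (chainComplex r A) (chainComplex r (A \ {x})) := by
  have hcollapse := h.deleteEdges_chainComplex_collapsesTo subset_rfl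
  rwa [sdiff_self, Set.bot_eq_empty, deleteEdges_empty] at hcollapse

theorem ElementaryCollapse.chainComplex_collapsesTo {X : Type*} [TopologicalSpace X] [Finite X]
    [T0Space X] {A A' : Set X} (h : ElementaryCollapse A A') :
    CollapsesTo (chainComplex (· ⤳ ·) A) (chainComplex (· ⤳ ·) A') := by
  obtain ⟨x, hx, rfl⟩ := h
  obtain hbelow | habove := (isWeakPoint_iff_contractibleSpace_strictlyBelow x).1 hx
  · exact (dismantlable_of_contractibleSpace _).chainComplex_collapsesTo
  · rw [← chainComplex_swap (A := A), ← chainComplex_swap (A := A \ {_})]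
    exact (dismantlable_of_contractibleSpace _).swap.chainComplex_collapsesTo

end ChainComplex

section HomotopyEquivalences

variable {A B C : Type u} [TopologicalSpace A] [TopologicalSpace B] [TopologicalSpace C]

theorem IsHomotopyInverse.symm {g : C(B, A)} {f : C(A, B)} (h : IsHomotopyInverse g f) :
    IsHomotopyInverse f g :=
  And.symm h

theorem IsHomotopyInverse.comp {g : C(B, A)} {f : C(A, B)} {g' : C(C, B)} {f' : C(B, C)}
    (h : IsHomotopyInverse g f) (h' : IsHomotopyInverse g' f') :
    IsHomotopyInverse (g.comp g') (f'.comp f) :=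
  let e := (ContinuousMap.HomotopyEquiv.mk f g h.1 h.2).trans ⟨f', g', h'.1, h'.2⟩
  ⟨e.left_inv, e.right_inv⟩

/-- The map `f` is a homotopy equivalence, as a property of the map rather than as the bundled
data of `ContinuousMap.HomotopyEquiv`. -/
def IsHomotopyEquiv (f : C(A, B)) : Prop :=
  ∃ g : C(B, A), IsHomotopyInverse g f

theorem IsHomotopyInverse.isHomotopyEquiv {g : C(B, A)} {f : C(A, B)}
    (h : IsHomotopyInverse g f) : IsHomotopyEquiv f :=
  ⟨g, h⟩

theorem IsHomotopyEquiv.id : IsHomotopyEquiv (ContinuousMap.id A) :=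
  ⟨.id A, .refl _, .refl _⟩

theorem IsHomotopyEquiv.comp {f : C(A, B)} {f' : C(B, C)} (h' : IsHomotopyEquiv f')
    (h : IsHomotopyEquiv f) : IsHomotopyEquiv (f'.comp f) :=
  let ⟨_, hg⟩ := h
  let ⟨_, hg'⟩ := h'
  (hg.comp hg').isHomotopyEquiv

theorem IsHomotopyEquiv.of_isEmpty [IsEmpty B] (f : C(A, B)) : IsHomotopyEquiv f := by
  have := Function.isEmpty f
  refine ⟨⟨isEmptyElim, continuous_iff_continuousAt.2 isEmptyElim⟩, ?_, ?_⟩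
  · exact ContinuousMap.ext (f := _) (g := .id A) isEmptyElim ▸ .refl _
  · exact ContinuousMap.ext (f := _) (g := .id B) isEmptyElim ▸ .refl _

theorem IsHomotopyEquiv.isHomotopyInverse_of_comp_eq_id {f : C(A, B)} {r : C(B, A)}
    (h : IsHomotopyEquiv f) (hr : r.comp f = .id A) : IsHomotopyInverse r f := by
  obtain ⟨g, -, hfg⟩ := h
  have hrg : (f.comp r).Homotopic (f.comp g) := by
    have hfr : ((f.comp r).comp (f.comp g)).Homotopic ((f.comp r).comp (.id B)) :=
      (ContinuousMap.Homotopic.refl _).comp hfg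
    have hcancel : (f.comp r).comp (f.comp g) = f.comp g := by
      rw [ContinuousMap.comp_assoc, ← ContinuousMap.comp_assoc r, hr, ContinuousMap.id_comp]
    exact (hcancel ▸ hfr).symm
  exact ⟨hr ▸ .refl _, hrg.trans hfg⟩

end HomotopyEquivalences

section Polyhedra

variable {V W : Type*} [Fintype V] [Fintype W]
  {K L : PreAbstractSimplicialComplex V} {M : PreAbstractSimplicialComplex W}
  {p q : stdSimplex ℝ V} {v : V} {s : Finset V}

open Classical in
/-- The carrier of a point of the standard simplex: the smallest face containing it. -/
def carrier (p : stdSimplex ℝ V) : Finset V := {v | p v ≠ 0}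

theorem mem_carrier : v ∈ carrier p ↔ p v ≠ 0 := by
  simp [carrier]

theorem carrier_subset_iff : carrier p ⊆ s ↔ ∀ v, p v ≠ 0 → v ∈ s :=
  forall_congr' fun _ => imp_congr_left mem_carrier

theorem carrier_nonempty (p : stdSimplex ℝ V) : (carrier p).Nonempty := by
  obtain ⟨v, -, hv⟩ := Finset.exists_ne_zero_of_sum_ne_zero (s := Finset.univ) (f := p) (by simp)
  exact ⟨v, mem_carrier.2 hv⟩

/-- The polyhedron of a simplicial complex. In contrast to `FinComplex.Realization` the complex need
not contain all vertices, so that subcomplexes are covered. -/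
def Polyhedron (K : PreAbstractSimplicialComplex V) : Type _ :=
  {p : stdSimplex ℝ V // ∃ s ∈ K, ∀ v, p v ≠ 0 → v ∈ s}

instance : TopologicalSpace (Polyhedron K) :=
  inferInstanceAs (TopologicalSpace {_p : stdSimplex ℝ V // _})

theorem exists_mem_carrier_subset_iff :
    (∃ s ∈ K, ∀ v, p v ≠ 0 → v ∈ s) ↔ carrier p ∈ K :=
  ⟨fun ⟨_, hs, hp⟩ => mem_of_subset hs (carrier_subset_iff.2 hp) (carrier_nonempty p),
    fun h => ⟨_, h, fun _ => mem_carrier.2⟩⟩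

theorem Polyhedron.carrier_mem (p : Polyhedron K) : carrier p.1 ∈ K :=
  exists_mem_carrier_subset_iff.1 p.2

/-- A continuous map into the standard simplex with carriers in `K`, as a map into the polyhedron
of `K`. -/
def Polyhedron.lift {A : Type*} [TopologicalSpace A] (F : C(A, stdSimplex ℝ V))
    (h : ∀ a, carrier (F a) ∈ K) : C(A, Polyhedron K) where
  toFun a := ⟨F a, exists_mem_carrier_subset_iff.2 (h a)⟩
  continuous_toFun := F.continuous.subtype_mk _

/-- The point which divides the segment from `p` to `q` in the ratio `t : 1 - t`. -/
def segmentPoint (p q : stdSimplex ℝ V) (t : unitInterval) : stdSimplex ℝ V :=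
  ⟨(1 - t : ℝ) • p.1 + (t : ℝ) • q.1,
    convex_stdSimplex ℝ V p.2 q.2 (sub_nonneg.2 t.2.2) t.2.1 (sub_add_cancel 1 (t : ℝ))⟩

theorem segmentPoint_zero : segmentPoint p q 0 = p :=
  Subtype.ext (by simp [segmentPoint])

theorem segmentPoint_one : segmentPoint p q 1 = q :=
  Subtype.ext (by simp [segmentPoint])

theorem carrier_segmentPoint_subset {t : unitInterval} (hp : carrier p ⊆ s)
    (hq : carrier q ⊆ s) : carrier (segmentPoint p q t) ⊆ s := by
  refine carrier_subset_iff.2 fun v hv => by_contra fun hvs => hv ?_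
  have hpv : p v = 0 := not_not.1 (mt (carrier_subset_iff.1 hp v) hvs)
  have hqv : q v = 0 := not_not.1 (mt (carrier_subset_iff.1 hq v) hvs)
  change (1 - t : ℝ) * p v + t * q v = 0
  rw [hpv, hqv, mul_zero, mul_zero, add_zero]

theorem continuous_segmentPoint :
    Continuous fun x : unitInterval × stdSimplex ℝ V × stdSimplex ℝ V =>
      segmentPoint x.2.1 x.2.2 x.1 := by
  unfold segmentPoint
  fun_prop

theorem homotopic_of_common_simplex {A : Type*} [TopologicalSpace A] {F G : C(A, Polyhedron K)}
    (h : ∀ a, ∃ s ∈ K, carrier (F a).1 ⊆ s ∧ carrier (G a).1 ⊆ s) : F.Homotopic G := by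
  let H : C(unitInterval × A, stdSimplex ℝ V) :=
    { toFun x := segmentPoint (F x.2).1 (G x.2).1 x.1
      continuous_toFun := by
        have hval (E : C(A, Polyhedron K)) : Continuous fun x : unitInterval × A => (E x.2).1 :=
          continuous_subtype_val.comp (E.continuous.comp continuous_snd)
        exact continuous_segmentPoint.comp (continuous_fst.prodMk ((hval F).prodMk (hval G))) }
  refine ⟨⟨Polyhedron.lift H fun x => ?_, fun a => ?_, fun a => ?_⟩⟩
  · obtain ⟨s, hs, hF, hG⟩ := h x.2
    exact mem_of_subset hs (carrier_segmentPoint_subset hF hG) (carrier_nonempty _)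
  · exact Subtype.ext segmentPoint_zero
  · exact Subtype.ext segmentPoint_one

theorem carrier_map [DecidableEq W] (f : V → W) (p : stdSimplex ℝ V) :
    carrier (stdSimplex.map f p) = (carrier p).image f := by
  ext w
  have hnonneg : ∀ v ∈ ({v | f v = w} : Finset V), 0 ≤ p v := fun v _ => stdSimplex.zero_le p v
  rw [mem_carrier, stdSimplex.map_coe, FunOnFinite.linearMap_apply_apply, Ne,
    Finset.sum_eq_zero_iff_of_nonneg hnonneg]
  simp [mem_carrier, and_comm]

/-- The map of polyhedra induced by a map of vertices which sends simplices to simplices. -/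
def Polyhedron.map [DecidableEq W] (f : V → W) (hf : ∀ s ∈ K, s.image f ∈ M) :
    C(Polyhedron K, Polyhedron M) :=
  Polyhedron.lift ⟨fun p => stdSimplex.map f p.1,
      (stdSimplex.continuous_map f).comp continuous_subtype_val⟩
    fun p => carrier_map f p.1 ▸ hf _ p.carrier_mem

/-- The inclusion of the polyhedron of a subcomplex. -/
def Polyhedron.inclusion (h : L ≤ K) : C(Polyhedron L, Polyhedron K) :=
  Polyhedron.lift ⟨Subtype.val, continuous_subtype_val⟩ fun p => h p.carrier_mem

theorem Polyhedron.coe_inclusion (h : L ≤ K) (p : Polyhedron L) :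
    (Polyhedron.inclusion h p).1 = p.1 :=
  rfl

theorem Polyhedron.inclusion_refl : Polyhedron.inclusion le_rfl = .id (Polyhedron K) :=
  rfl

theorem Polyhedron.inclusion_comp_map [DecidableEq W] {M' : PreAbstractSimplicialComplex W}
    (f : V → W) (hf : ∀ s ∈ K, s.image f ∈ M') (h : M' ≤ M) (hfM : ∀ s ∈ K, s.image f ∈ M) :
    (Polyhedron.inclusion h).comp (Polyhedron.map f hf) = Polyhedron.map f hfM :=
  rfl

theorem Polyhedron.inclusion_comp_inclusion {L' : PreAbstractSimplicialComplex V} (h' : L' ≤ L)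
    (h : L ≤ K) : (Polyhedron.inclusion h).comp (Polyhedron.inclusion h') =
      Polyhedron.inclusion (h'.trans h) :=
  rfl

theorem Polyhedron.carrier_map_apply [DecidableEq W] (f : V → W) (hf : ∀ s ∈ K, s.image f ∈ M)
    (p : Polyhedron K) : carrier (Polyhedron.map f hf p).1 = (carrier p.1).image f :=
  carrier_map f p.1

theorem Polyhedron.map_comp_map_homotopic_id [DecidableEq V] [DecidableEq W] {f : V → W} {g : W → V}
    (hf : ∀ s ∈ K, s.image f ∈ M) (hg : ∀ t ∈ M, t.image g ∈ K)
    (h : ∀ s ∈ K, (s.image f).image g ⊆ s) :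
    ((Polyhedron.map g hg).comp (Polyhedron.map f hf)).Homotopic (.id _) := by
  refine homotopic_of_common_simplex fun p => ⟨_, p.carrier_mem, ?_, subset_rfl⟩
  rw [ContinuousMap.comp_apply, carrier_map_apply, carrier_map_apply]
  exact h _ p.carrier_mem

theorem Polyhedron.isHomotopyEquiv_map_of_injective {V W : Type u} [Fintype V] [Fintype W]
    [DecidableEq W] {K : PreAbstractSimplicialComplex V} {f : V → W} (hf : Function.Injective f)
    (h : ∀ s ∈ K, s.image f ∈ K.map f) : IsHomotopyEquiv (Polyhedron.map f h) := by
  classical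
  cases isEmpty_or_nonempty V with
  | inl _ =>
    have : IsEmpty (Polyhedron (K.map f)) := ⟨fun q => by
      obtain ⟨s, hs, -⟩ := q.carrier_mem
      exact isEmptyElim (nonempty_of_mem hs).choose⟩
    exact .of_isEmpty _
  | inr _ =>
    obtain ⟨g, hg⟩ := hf.hasLeftInverse
    have himage (s : Finset V) : (s.image f).image g = s := by
      rw [Finset.image_image, hg.comp_eq_id, Finset.image_id]
    have hback : ∀ t ∈ K.map f, t.image g ∈ K := by
      rintro _ ⟨s, hs, rfl⟩
      exact (himage s).symm ▸ hs
    refine ⟨Polyhedron.map g hback, map_comp_map_homotopic_id h hback fun s _ => (himage s).le,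
      map_comp_map_homotopic_id hback h ?_⟩
    rintro _ ⟨s, -, rfl⟩
    exact (congrArg _ (himage s)).le

end Polyhedra

section PushOff

variable {V : Type*} [Fintype V] {S : Finset V} {a : V} {p : stdSimplex ℝ V}

theorem inf'_stdSimplex_nonneg (hS : S.Nonempty) (p : stdSimplex ℝ V) : 0 ≤ S.inf' hS p :=
  Finset.le_inf' _ _ fun v _ => stdSimplex.zero_le p v

variable [DecidableEq V]

/-- The point `p` pushed away from the face `S` towards the vertex `a`: all coordinates in `S` are
decreased by the smallest of them, and their total decrease is added to the coordinate of `a`. -/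
def pushOff (hS : S.Nonempty) (a : V) (p : stdSimplex ℝ V) : stdSimplex ℝ V :=
  ⟨fun v => p v - (if v ∈ S then S.inf' hS p else 0) +
      (if v = a then S.card * S.inf' hS p else 0), by
    have hm := inf'_stdSimplex_nonneg hS p
    refine ⟨fun v => add_nonneg (sub_nonneg.2 ?_) (by split_ifs <;> positivity), ?_⟩
    · split_ifs with hv
      · exact Finset.inf'_le _ hv
      · exact stdSimplex.zero_le p v
    · simp [Finset.sum_add_distrib, Finset.sum_sub_distrib, Finset.sum_ite_mem]⟩

theorem pushOff_apply (hS : S.Nonempty) (a : V) (p : stdSimplex ℝ V) (v : V) :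
    pushOff hS a p v = p v - (if v ∈ S then S.inf' hS p else 0) +
      (if v = a then S.card * S.inf' hS p else 0) :=
  rfl

theorem continuous_pushOff (hS : S.Nonempty) (a : V) : Continuous (pushOff hS a) := by
  have happly (v : V) : Continuous fun p : stdSimplex ℝ V => p v :=
    (continuous_apply v).comp continuous_subtype_val
  have hm : Continuous fun p : stdSimplex ℝ V => S.inf' hS p :=
    Continuous.finset_inf'_apply hS fun v _ => happly v
  refine Continuous.subtype_mk (continuous_pi fun v => ?_) _
  refine ((happly v).sub ?_).add ?_
  · split_ifs <;> fun_prop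
  · split_ifs <;> fun_prop

theorem pushOff_eq_self (hS : S.Nonempty) (a : V) (h : ¬ S ⊆ carrier p) : pushOff hS a p = p := by
  obtain ⟨w, hw, hwp⟩ := Finset.not_subset.1 h
  have hpw : p w = 0 := not_not.1 (mt mem_carrier.2 hwp)
  have hm : S.inf' hS p = 0 :=
    le_antisymm ((Finset.inf'_le _ hw).trans hpw.le) (inf'_stdSimplex_nonneg hS p)
  exact stdSimplex.ext (funext fun v => by simp [pushOff_apply, hm])

theorem not_subset_carrier_pushOff (hS : S.Nonempty) (ha : a ∉ S) :
    ¬ S ⊆ carrier (pushOff hS a p) := fun h => by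
  obtain ⟨w, hw, hm⟩ := S.exists_mem_eq_inf' hS p
  have hwa : w ≠ a := ne_of_mem_of_not_mem hw ha
  exact mem_carrier.1 (h hw) (by simp [pushOff_apply, hw, hwa, hm])

theorem carrier_pushOff_subset (hS : S.Nonempty) :
    carrier (pushOff hS a p) ⊆ insert a (carrier p) := by
  by_cases hSp : S ⊆ carrier p
  · refine carrier_subset_iff.2 fun v hv => ?_
    by_contra hvap
    rw [Finset.mem_insert, not_or] at hvap
    have hvS : v ∉ S := fun h => hvap.2 (hSp h)
    exact hv (by simp [pushOff_apply, hvS, hvap.1, not_not.1 (mt mem_carrier.2 hvap.2)])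
  · rw [pushOff_eq_self hS a hSp]
    exact Finset.subset_insert a _

end PushOff

section Collapses

variable {V : Type u} [Fintype V] {K L : PreAbstractSimplicialComplex V}

theorem exists_common_simplex_pushOff [DecidableEq V] {S : Finset V} {a : V} {p : stdSimplex ℝ V}
    (hS : S.Nonempty) (haS : insert a S ∈ K) (hfree : ∀ t ∈ K, S ⊆ t → t ⊆ insert a S)
    (hp : carrier p ∈ K) :
    ∃ s ∈ K, carrier (pushOff hS a p) ⊆ s ∧ carrier p ⊆ s := by
  by_cases hSp : S ⊆ carrier p
  · have hpaS := hfree _ hp hSp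
    exact ⟨insert a S, haS,
      (carrier_pushOff_subset hS).trans (Finset.insert_subset (Finset.mem_insert_self a S) hpaS),
      hpaS⟩
  · exact ⟨carrier p, hp, (pushOff_eq_self hS a hSp).symm ▸ subset_rfl, subset_rfl⟩

theorem ElementarySimplicialCollapse.isHomotopyEquiv_inclusion
    (h : ElementarySimplicialCollapse K L) (hLK : L ≤ K) :
    IsHomotopyEquiv (Polyhedron.inclusion hLK) := by
  classical
  obtain ⟨S, a, hS, ha, haS, hfree, rfl⟩ := elementarySimplicialCollapse_iff_exists_free_face.1 h
  have hcommon (p : Polyhedron K) := exists_common_simplex_pushOff hS haS hfree p.carrier_mem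
  let r : C(Polyhedron K, Polyhedron (deleteFace K S)) :=
    Polyhedron.lift ⟨fun p => pushOff hS a p.1,
        (continuous_pushOff hS a).comp continuous_subtype_val⟩ fun p => by
      obtain ⟨s, hs, hps, -⟩ := hcommon p
      exact ⟨mem_of_subset hs hps (carrier_nonempty _), not_subset_carrier_pushOff hS ha⟩
  refine ⟨r, ?_, homotopic_of_common_simplex fun p => ?_⟩
  · have hr : r.comp (Polyhedron.inclusion hLK) = .id _ := ContinuousMap.ext fun p => Subtype.ext
      ((congrArg _ (Polyhedron.coe_inclusion hLK p)).trans (pushOff_eq_self hS a p.carrier_mem.2))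
    exact hr ▸ .refl _
  · rw [ContinuousMap.comp_apply, Polyhedron.coe_inclusion]
    exact hcommon p

theorem CollapsesTo.isHomotopyEquiv_inclusion (h : CollapsesTo K L) :
    IsHomotopyEquiv (Polyhedron.inclusion h.le) := by
  induction h with
  | refl => exact (Polyhedron.inclusion_refl (K := K)).symm ▸ .id
  | tail hK h ih =>
    have hcomp := ih.comp (h.isHomotopyEquiv_inclusion (CollapsesTo.le (.single h)))
    rwa [Polyhedron.inclusion_comp_inclusion] at hcomp

end Collapses

section Expansions

variable {K L M : FinComplex.{u}}

theorem SimplicialMap.IsExpansion.isHomotopyEquiv {φ : SimplicialMap L K} (h : φ.IsExpansion) :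
    IsHomotopyEquiv φ.realize := by
  classical
  obtain ⟨hφ, hcol⟩ := h
  have himage : ∀ s ∈ L.cplx.toPreAbstractSimplicialComplex,
      s.image φ.toFun ∈ L.cplx.toPreAbstractSimplicialComplex.map φ.toFun :=
    fun s hs => ⟨s, hs, rfl⟩
  have hcomp := (CollapsesTo.isHomotopyEquiv_inclusion hcol).comp
    (Polyhedron.isHomotopyEquiv_map_of_injective hφ himage)
  rwa [Polyhedron.inclusion_comp_map (hfM := φ.image_mem)] at hcomp

theorem isSimpleHomotopyEquiv_comp_realize {φ : SimplicialMap K M} {ψ : SimplicialMap L M}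
    (hφ : φ.IsExpansion) (hψ : ψ.IsExpansion) {r : C(M.Realization, L.Realization)}
    (hr : IsHomotopyInverse r ψ.realize) : IsSimpleHomotopyEquiv (r.comp φ.realize) :=
  ⟨hr.symm.isHomotopyEquiv.comp hφ.isHomotopyEquiv, _,
    .contract (.expand (.refl K) φ hφ) ψ hψ r hr, .refl _⟩

end Expansions

section OrderComplexes

theorem chainComplex_map {α β : Type*} [DecidableEq β] {r : α → α → Prop} {q : β → β → Prop}
    (g : r ↪r q) (A : Set α) : (chainComplex r A).map g = chainComplex q (g '' A) := by
  refine SetLike.ext fun s => ⟨?_, ?_⟩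
  · rintro ⟨t, ⟨ht, htA, hchain⟩, rfl⟩
    refine ⟨ht.image g, ?_, ?_⟩ <;> rw [Finset.coe_image]
    · exact Set.image_mono htA
    · exact hchain.image g
  · rintro ⟨hs, hsA, hchain⟩
    obtain ⟨t, htA, rfl⟩ := Finset.subset_set_image_iff.1 hsA
    rw [Finset.coe_image, IsChain.image_relEmbedding_iff] at hchain
    exact ⟨t, ⟨Finset.image_nonempty.1 hs, htA, hchain⟩, rfl⟩

variable {X Y Z : Type u} [TopologicalSpace X] [TopologicalSpace Y] [TopologicalSpace Z]
  [Fintype X] [Fintype Y] [Fintype Z]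

theorem orderComplex_cplx_eq_chainComplex :
    (orderComplex X).cplx.toPreAbstractSimplicialComplex =
      chainComplex (α := X) (· ⤳ ·) Set.univ := by
  ext s : 2
  change _ ∧ IsChain (fun a b : X => a ∈ minOpen b) _ ↔
    _ ∧ (_ : Set X) ⊆ _ ∧ IsChain (fun a b : X => a ⤳ b) _
  simp only [mem_minOpen_iff, Set.subset_univ, true_and]

theorem IsSpaceExpansion.isExpansion_orderComplexMap [T0Space Y] {i : C(X, Y)}
    (hi : IsSpaceExpansion i) : (orderComplexMap i).IsExpansion := by
  classical
  obtain ⟨hemb, hcol⟩ := hi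
  let g : ((· ⤳ ·) : X → X → Prop) ↪r ((· ⤳ ·) : Y → Y → Prop) :=
    ⟨⟨i, hemb.injective⟩, hemb.isInducing.specializes_iff⟩
  refine ⟨hemb.injective, ?_⟩
  have hmap : (chainComplex (α := X) (· ⤳ ·) Set.univ).map i =
      chainComplex (· ⤳ ·) (Set.range i) := by
    rw [← Set.image_univ]
    exact chainComplex_map g Set.univ
  rw [orderComplex_cplx_eq_chainComplex, orderComplex_cplx_eq_chainComplex]
  change CollapsesTo _ ((chainComplex (α := X) (· ⤳ ·) Set.univ).map i)
  rw [hmap]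
  exact hcol.lift' (chainComplex (· ⤳ ·)) fun _ _ => ElementaryCollapse.chainComplex_collapsesTo

theorem realize_orderComplexMap_comp (g : C(Y, Z)) (f : C(X, Y)) :
    (orderComplexMap (g.comp f)).realize =
      (orderComplexMap g).realize.comp (orderComplexMap f).realize :=
  ContinuousMap.ext fun p => Subtype.ext (stdSimplex.map_comp_apply f g p.1).symm

theorem realize_orderComplexMap_id :
    (orderComplexMap (.id X)).realize = .id (orderComplex X).Realization :=
  ContinuousMap.ext fun p => Subtype.ext (stdSimplex.map_id_apply p.1)

end OrderComplexes

section Removal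

open Relation

theorem reflTransGen_elementaryCollapse_of_minimal {X : Type*} [TopologicalSpace X] [Finite X]
    (r : X → X → Prop) [IsPartialOrder X r] {A B : Set X} (hBA : B ⊆ A)
    (h : ∀ A', B ⊆ A' → ∀ x : A', ↑x ∉ B → (∀ y ∈ A', y ∉ B → r y x → y = x) → IsWeakPoint x) :
    ReflTransGen ElementaryCollapse A B := by
  induction A using WellFoundedLT.induction with
  | _ A ih =>
    obtain rfl | hne := eq_or_ne A B
    · exact .refl
    · obtain ⟨x, ⟨hxA, hxB⟩, hmin⟩ := (wellFounded_rel_and_ne r).has_min (A \ B)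
        (Set.sdiff_nonempty.2 fun hAB => hne (hAB.antisymm hBA))
      have hx : IsWeakPoint (⟨x, hxA⟩ : A) := h A hBA _ hxB fun y hyA hyB hyx =>
        by_contra fun hne => hmin y ⟨hyA, hyB⟩ ⟨hyx, hne⟩
      exact .head ⟨_, hx, rfl⟩ (ih _ (Set.sdiff_singleton_ssubset.2 hxA)
        (Set.subset_sdiff_singleton hBA hxB))

end Removal

namespace Cylinder

open Function

variable {X Y : Type u} [TopologicalSpace X] [TopologicalSpace Y] (f : C(X, Y))

section

variable {f}

theorem exists_eq_inl_or_exists_eq_inr (z : Cylinder f) :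
    (∃ x, z = inl f x) ∨ ∃ y, z = inr f y :=
  Sum.rec (fun x => .inl ⟨x, rfl⟩) (fun y => .inr ⟨y, rfl⟩) z

theorem inl_ne_inr {x : X} {y : Y} : inl f x ≠ inr f y := Sum.inl_ne_inr

theorem inr_notMem_range_inl {y : Y} : inr f y ∉ Set.range (inl f) :=
  fun ⟨_, h⟩ => inl_ne_inr h

theorem inl_notMem_range_inr {x : X} : inl f x ∉ Set.range (inr f) :=
  fun ⟨_, h⟩ => inl_ne_inr h.symm

theorem specializes_iff_le {a b : Cylinder f} : a ⤳ b ↔ le f a b :=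
  mem_minOpen_iff.symm.trans (mem_minOpen_iff_le f a b)

theorem inl_specializes_inl {a b : X} : inl f a ⤳ inl f b ↔ a ⤳ b :=
  specializes_iff_le.trans mem_minOpen_iff

theorem inr_specializes_inr {a b : Y} : inr f a ⤳ inr f b ↔ a ⤳ b :=
  specializes_iff_le.trans mem_minOpen_iff

theorem inl_specializes_inr {a : X} {b : Y} : inl f a ⤳ inr f b ↔ f a ⤳ b :=
  specializes_iff_le.trans mem_minOpen_iff

theorem not_inr_specializes_inl {a : Y} {b : X} : ¬ inr f a ⤳ inl f b :=
  specializes_iff_le.not.2 id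

theorem strictlyBelow_inr {A : Set (Cylinder f)} (hA : Set.range (inl f) ⊆ A) {y : Y}
    (hmin : ∀ z ∈ A, z ∉ Set.range (inl f) → z ⤳ inr f y → z = inr f y) :
    strictlyBelow (· ⤳ ·) A (inr f y) = inl f '' (f ⁻¹' minOpen y) := by
  ext z
  obtain ⟨x, rfl⟩ | ⟨y', rfl⟩ := exists_eq_inl_or_exists_eq_inr z
  · constructor
    · exact fun hx => ⟨x, mem_minOpen_iff.2 (inl_specializes_inr.1 hx.2.1), rfl⟩
    · rintro ⟨x', hx', h⟩
      exact ⟨hA ⟨x, rfl⟩, h ▸ inl_specializes_inr.2 (mem_minOpen_iff.1 hx'), inl_ne_inr⟩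
  · refine iff_of_false (fun hy => hy.2.2 (hmin _ hy.1 inr_notMem_range_inl hy.2.1)) ?_
    rintro ⟨_, -, h⟩
    exact inl_ne_inr h

end

/-- The retraction of the cylinder onto `Y` along `f`. -/
def retraction [Finite X] [Finite Y] : C(Cylinder f, Y) where
  toFun := Sum.elim f id
  continuous_toFun := continuous_of_specializes fun a b hab => by
    obtain ⟨x, rfl⟩ | ⟨y, rfl⟩ := exists_eq_inl_or_exists_eq_inr a <;>
      obtain ⟨x', rfl⟩ | ⟨y', rfl⟩ := exists_eq_inl_or_exists_eq_inr b
    · exact (inl_specializes_inl.1 hab).map f.continuous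
    · exact inl_specializes_inr.1 hab
    · exact (not_inr_specializes_inl hab).elim
    · exact inr_specializes_inr.1 hab

variable [Finite X] [Finite Y]

theorem isEmbedding_inl [T0Space X] : IsEmbedding (inl f) :=
  isEmbedding_of_specializes_iff fun _ _ => inl_specializes_inl

theorem isEmbedding_inr [T0Space Y] : IsEmbedding (inr f) :=
  isEmbedding_of_specializes_iff fun _ _ => inr_specializes_inr

theorem isSpaceExpansion_inr [T0Space X] [T0Space Y] : IsSpaceExpansion (inr f) := by
  have : IsPartialOrder (Cylinder f) (swap (· ⤳ ·)) := inferInstance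
  refine ⟨isEmbedding_inr f, reflTransGen_elementaryCollapse_of_minimal (swap (· ⤳ ·))
    (Set.subset_univ _) fun A hA z hz hmax => ?_⟩
  obtain ⟨z, hzA⟩ := z
  obtain ⟨x, rfl⟩ | ⟨y, rfl⟩ := exists_eq_inl_or_exists_eq_inr z
  · refine (isWeakPoint_iff_contractibleSpace_strictlyBelow _).2 (.inr ?_)
    refine contractibleSpace_of_forall_specializes (c := ⟨inr f (f x), hA ⟨f x, rfl⟩,
      inl_specializes_inr.2 specializes_rfl, inl_ne_inr.symm⟩) ?_
    rintro ⟨w, hwA, hxw, hne⟩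
    rw [subtype_specializes_iff]
    obtain ⟨x', rfl⟩ | ⟨y, rfl⟩ := exists_eq_inl_or_exists_eq_inr w
    · exact (hne (hmax _ hwA inl_notMem_range_inr hxw)).elim
    · exact inr_specializes_inr.2 (inl_specializes_inr.1 hxw)
  · exact (hz ⟨y, rfl⟩).elim

variable {f} in
theorem isSpaceExpansion_inl [T0Space X] [T0Space Y] (hf : IsDistinguished f) :
    IsSpaceExpansion (inl f) := by
  refine ⟨isEmbedding_inl f, reflTransGen_elementaryCollapse_of_minimal (· ⤳ ·)
    (Set.subset_univ _) fun A hA z hz hmin => ?_⟩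
  obtain ⟨z, hzA⟩ := z
  obtain ⟨x, rfl⟩ | ⟨y, rfl⟩ := exists_eq_inl_or_exists_eq_inr z
  · exact (hz ⟨x, rfl⟩).elim
  · refine (isWeakPoint_iff_contractibleSpace_strictlyBelow _).2 (.inl ?_)
    rw [strictlyBelow_inr hA hmin]
    have := hf y
    exact ((isEmbedding_inl f).homeomorphImage _).symm.contractibleSpace

end Cylinder

end FiniteSpaces

end

theorem mainTheorem4 {X Y : Type u} [TopologicalSpace X] [T0Space X] [Fintype X]
    [TopologicalSpace Y] [T0Space Y] [Fintype Y] (f : C(X, Y))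
    (hf : FiniteSpaces.IsDistinguished f) :
    FiniteSpaces.IsSimpleHomotopyEquiv (FiniteSpaces.orderComplexMap f).realize ∧
      FiniteSpaces.IsSpaceExpansion (FiniteSpaces.Cylinder.inl f) ∧
      FiniteSpaces.IsSpaceExpansion (FiniteSpaces.Cylinder.inr f) := by
  open FiniteSpaces Cylinder in
  have hX := isSpaceExpansion_inl hf
  have hY := isSpaceExpansion_inr f
  refine ⟨?_, hX, hY⟩
  let _ : Fintype (Cylinder f) := Fintype.ofFinite _
  let i : C(X, Cylinder f) := ⟨inl f, hX.1.continuous⟩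
  let j : C(Y, Cylinder f) := ⟨inr f, hY.1.continuous⟩
  have hi : (orderComplexMap i).IsExpansion := IsSpaceExpansion.isExpansion_orderComplexMap hX
  have hj : (orderComplexMap j).IsExpansion := IsSpaceExpansion.isExpansion_orderComplexMap hY
  have hj_retract : (orderComplexMap (retraction f)).realize.comp (orderComplexMap j).realize =
      .id (orderComplex Y).Realization :=
    (realize_orderComplexMap_comp (retraction f) j).symm.trans realize_orderComplexMap_id
  have hr : IsHomotopyInverse (orderComplexMap (retraction f)).realize
      (orderComplexMap j).realize := hj.isHomotopyEquiv.isHomotopyInverse_of_comp_eq_id hj_retract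
  have hfactor : (orderComplexMap f).realize =
      (orderComplexMap (retraction f)).realize.comp (orderComplexMap i).realize :=
    realize_orderComplexMap_comp (retraction f) i
  exact hfactor ▸ isSimpleHomotopyEquiv_comp_realize hi hj hr
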